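/- Let $d\ge 1$, let $\mathcal A$ be a finite alphabet, and let $\mathcal F$ be a finite set of forbidden patterns $w\in\mathcal A^{I(w)}$ on finite windows $I(w)\subset\mathbb Z^d$, such that the subshift of finite type $$\Omega_{\mathcal F}=\{\omega\in\mathcal A^{\mathbb Z^d}:\ \forall w\in\mathcal F,\ \forall k\in\mathbb Z^d,\ \sigma_k(\omega)|_{I(w)}\ne w\},\qquad \sigma_k(\omega)_l=\omega_{k+l},$$ is non-empty. Let $\mathcal F'$ be the set of $(d+1)$-dimensional patterns $w'\in\mathcal A^{I(w)\times\{0\}}$, $w'_{(k,0)}=w_k$, for $w\in\mathcal F$, so that $\Omega_{\mathcal F'}$ consists of the configurations on $\mathbb Z^{d+1}$ all of whose layers $\mathbb Z^d\times\{i\}$, $i\in\mathbb Z$, carry a configuration of $\Omega_{\mathcal F}$. Let $\mathcal N'$ be any set of shift-invariant probability measures on $\{0,1\}^{\mathbb Z^{d+1}}$, let $\zeta$ be the restriction of configurations on $\mathbb Z^{d+1}$ to $\mathbb Z^d\times\{0\}\cong\mathbb Z^d$, and let $\mathcal N=\{\zeta^*\nu':\nu'\in\mathcal N'\}$ be the set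 of the pushforwards of the measures of $\mathcal N'$. Definitions (in any dimension $d$). $\mathcal M_{\mathcal F}$ is the set of shift-invariant probability measures carried by $\Omega_{\mathcal F}$. For $\epsilon\in[0,1]$, an $\epsilon$-noise is a shift-invariant probability measure $\nu$ on $\{0,1\}^{\mathbb Z^d}$ with $\nu(b_0=1)\le\epsilon$. $\mathcal M_{\mathcal F}^{\mathcal N}(\epsilon)$ is the set of the first marginals $\pi_1^*\lambda$ of the shift-invariant probability measures $\lambda$ on $(\mathcal A\times\{0,1\})^{\mathbb Z^d}$ such that $\pi_2^*\lambda$ is an $\epsilon$-noise that belongs to $\mathcal N$ and such that $\lambda$-almost surely no pattern $(w,0^{I(w)})$ with $w\in\mathcal F$ occurs. For configurations $x,y$ put $d_H(x,y)=\limsup_{n\to\infty}\frac{|\{k\in B_n:x_k\ne y_k\}|}{|B_n|}$ with $B_n=\{-n,\dots,n\}^d$, and for shift-invariant probability measures $\mu,\nu$ on $\mathcal A^{\mathbb Z^d}$ put $d_B(\mu,\nu)=\inf_\lambda\int d_H(x,y)\,\mathrm d\lambda(x,y)$, where $\lambda$ runs over the shift-invariant couplings of $\mu$ and $\nu$. For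 a non-decreasing function $f:[0,1]\to\mathbb R^+$, right-continuous at $0$ with $f(0)=0$, the SFT $\Omega_{\mathcal F}$ is $f$-stable (for $d_B$) on the class $\mathcal N$ if $$\forall\epsilon\in[0,1],\quad \sup_{\mu\in\mathcal M_{\mathcal F}^{\mathcal N}(\epsilon)}\ \inf_{\nu\in\mathcal M_{\mathcal F}}d_B(\mu,\nu)\le f(\epsilon)$$ (a supremum over the empty set being $0$). It is stable on $\mathcal N$ if it is $f$-stable on $\mathcal N$ for some such $f$, and unstable on $\mathcal N$ otherwise. Claim. For every such $f$, the $d$-dimensional SFT $\Omega_{\mathcal F}$ is $f$-stable on $\mathcal N$ if and only if the $(d+1)$-dimensional SFT $\Omega_{\mathcal F'}$ is $f$-stable on $\mathcal N'$. Moreover, $\Omega_{\mathcal F}$ is unstable on $\mathcal N$ if and only if $\Omega_{\mathcal F'}$ is unstable on $\mathcal N'$. -/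

import Mathlib

open MeasureTheory Filter Topology
open scoped ENNReal NNReal

namespace NoisySFT

noncomputable section

/-- Configurations over the alphabet `A` on the lattice `ℤ^d`; the σ-algebra is the product one
(the Borel σ-algebra of the product of the discrete topologies when `A` is finite and discrete). -/
abbrev Config (d : ℕ) (A : Type*) : Type _ := (Fin d → ℤ) → A

/-- The shift `σ_k(ω)_l = ω_{k+l}`. -/
def shift {d : ℕ} {A : Type*} (k : Fin d → ℤ) (ω : Config d A) : Config d A :=
  fun l => ω (k + l)

/-- A finite pattern: a word on a finite window of cells. -/
structure Pattern (d : ℕ) (A : Type*) where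
  window : Finset (Fin d → ℤ)
  word : window → A

/-- The SFT defined by a set `F` of forbidden patterns: no shift of `ω` restricted to
the window of a forbidden pattern `w` equals `w`. -/
def sft {d : ℕ} {A : Type*} (F : Set (Pattern d A)) : Set (Config d A) :=
  {ω | ∀ w ∈ F, ∀ k : Fin d → ℤ, (fun l : w.window => shift k ω l.1) ≠ w.word}

/-- The shift-invariant probability measures on the full shift. -/
def invMeasures (d : ℕ) (A : Type*) [MeasurableSpace A] : Set (Measure (Config d A)) :=
  {μ | IsProbabilityMeasure μ ∧ ∀ k : Fin d → ℤ, μ.map (shift k) = μ}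

/-- The shift-invariant probability measures carried by the SFT of `F`. -/
def sftMeasures {d : ℕ} {A : Type*} [MeasurableSpace A] (F : Set (Pattern d A)) :
    Set (Measure (Config d A)) :=
  {μ | μ ∈ invMeasures d A ∧ ∀ᵐ ω ∂μ, ω ∈ sft F}

/-- First projection, applied cell by cell. -/
def projFst {d : ℕ} {A B : Type*} (ω : Config d (A × B)) : Config d A := fun k => (ω k).1

/-- Second projection, applied cell by cell. -/
def projSnd {d : ℕ} {A B : Type*} (ω : Config d (A × B)) : Config d B := fun k => (ω k).2

/-- The clear version `(w, 0)` of a pattern, on the alphabet `A × {0,1}`. -/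
def Pattern.clear {d : ℕ} {A : Type*} (w : Pattern d A) : Pattern d (A × Fin 2) where
  window := w.window
  word := fun l => (w.word l, 0)

/-- The set of forbidden clear patterns. -/
def clearPatterns {d : ℕ} {A : Type*} (F : Set (Pattern d A)) : Set (Pattern d (A × Fin 2)) :=
  Pattern.clear '' F

/-- `ν` is an `ε`-noise: shift-invariant, and a given cell is obscured (has value `1`) with
probability at most `ε`. -/
def IsNoise {d : ℕ} (ε : unitInterval) (ν : Measure (Config d (Fin 2))) : Prop :=
  ν ∈ invMeasures d (Fin 2) ∧ ν {b | b 0 = 1} ≤ ENNReal.ofReal (ε : ℝ)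

/-- The noisy measures, on the alphabet `A × {0,1}`, whose noise is an `ε`-noise of the
class `N`. -/
def noisyMeasuresTilde {d : ℕ} {A : Type*} [MeasurableSpace A] (F : Set (Pattern d A))
    (N : Set (Measure (Config d (Fin 2)))) (ε : unitInterval) :
    Set (Measure (Config d (A × Fin 2))) :=
  {l | l ∈ sftMeasures (clearPatterns F) ∧ l.map projSnd ∈ N ∧ IsNoise ε (l.map projSnd)}

/-- The projection of the noisy measures to the alphabet `A`. -/
def noisyMeasures {d : ℕ} {A : Type*} [MeasurableSpace A] (F : Set (Pattern d A))
    (N : Set (Measure (Config d (Fin 2)))) (ε : unitInterval) : Set (Measure (Config d A)) :=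
  (fun l => l.map projFst) '' noisyMeasuresTilde F N ε

/-- The box `B_n = [-n, n]^d`. -/
def box (d n : ℕ) : Finset (Fin d → ℤ) :=
  Finset.Icc (fun _ => -(n : ℤ)) (fun _ => (n : ℤ))

open Classical in
/-- The Hamming distance of two configurations on a finite window: the proportion of cells of
the window where they differ. -/
def hamming {d : ℕ} {A : Type*} (J : Finset (Fin d → ℤ)) (x y : Config d A) : ℝ≥0∞ :=
  ((J.filter fun k => x k ≠ y k).card : ℝ≥0∞) / (J.card : ℝ≥0∞)

/-- The Hamming-Besicovitch pseudometric, along the boxes `B_n`. -/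
def dH {d : ℕ} {A : Type*} (x y : Config d A) : ℝ≥0∞ :=
  limsup (fun n : ℕ => hamming (box d n) x y) atTop

/-- The (shift-invariant) couplings of two measures. -/
def couplings {d : ℕ} {A : Type*} [MeasurableSpace A] (μ ν : Measure (Config d A)) :
    Set (Measure (Config d (A × A))) :=
  {l | l ∈ invMeasures d (A × A) ∧ l.map projFst = μ ∧ l.map projSnd = ν}

/-- The Besicovitch distance between shift-invariant measures. -/
def dB {d : ℕ} {A : Type*} [MeasurableSpace A] (μ ν : Measure (Config d A)) : ℝ≥0∞ :=
  ⨅ l ∈ couplings μ ν, ∫⁻ z, dH (projFst z) (projSnd z) ∂l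

/-- The functions allowed as convergence speeds: non-decreasing `f : [0,1] → ℝ⁺`,
right-continuous at `0`, with `f 0 = 0`. -/
structure IsSpeed (f : unitInterval → ℝ≥0) : Prop where
  mono : Monotone f
  rightCts : ContinuousWithinAt f (Set.Ioi 0) 0
  zero : f 0 = 0

/-- The SFT of `F` is `f`-stable, on the class `N`, for the distance `dist`. -/
def IsFStable {d : ℕ} {A : Type*} [MeasurableSpace A]
    (dist : Measure (Config d A) → Measure (Config d A) → ℝ≥0∞)
    (F : Set (Pattern d A)) (N : Set (Measure (Config d (Fin 2)))) (f : unitInterval → ℝ≥0) :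
    Prop :=
  ∀ ε : unitInterval, (⨆ μ ∈ noisyMeasures F N ε, ⨅ ν ∈ sftMeasures F, dist μ ν) ≤ (f ε : ℝ≥0∞)

/-- The SFT of `F` is stable, on the class `N`, for the distance `dist`. -/
def IsStable {d : ℕ} {A : Type*} [MeasurableSpace A]
    (dist : Measure (Config d A) → Measure (Config d A) → ℝ≥0∞)
    (F : Set (Pattern d A)) (N : Set (Measure (Config d (Fin 2)))) : Prop :=
  ∃ f : unitInterval → ℝ≥0, IsSpeed f ∧ IsFStable dist F N f

/-- The SFT of `F` is unstable, on the class `N`, for the distance `dist`. -/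
def IsUnstable {d : ℕ} {A : Type*} [MeasurableSpace A]
    (dist : Measure (Config d A) → Measure (Config d A) → ℝ≥0∞)
    (F : Set (Pattern d A)) (N : Set (Measure (Config d (Fin 2)))) : Prop :=
  ¬ IsStable dist F N

/-- The cell `(k, 0)` of `ℤ^{d+1}`. -/
def baseCell {d : ℕ} (k : Fin d → ℤ) : Fin (d + 1) → ℤ := Fin.snoc (α := fun _ => ℤ) k 0

theorem init_baseCell {d : ℕ} (k : Fin d → ℤ) : Fin.init (α := fun _ => ℤ) (baseCell k) = k := by
  simp [baseCell]

theorem baseCell_injective {d : ℕ} : Function.Injective (baseCell (d := d)) := fun k l h => by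
  rw [← init_baseCell k, h, init_baseCell]

theorem init_mem {d : ℕ} {J : Finset (Fin d → ℤ)} {k : Fin (d + 1) → ℤ}
    (hk : k ∈ J.map ⟨baseCell, baseCell_injective⟩) : Fin.init (α := fun _ => ℤ) k ∈ J := by
  obtain ⟨l, hl, rfl⟩ := Finset.mem_map.1 hk
  simpa [init_baseCell] using hl

/-- The `(d+1)`-dimensional version of a pattern `w`: the same word on the window
`I(w) × {0}`. -/
def Pattern.extend {d : ℕ} {A : Type*} (w : Pattern d A) : Pattern (d + 1) A where
  window := w.window.map ⟨baseCell, baseCell_injective⟩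
  word := fun k => w.word ⟨Fin.init (α := fun _ => ℤ) k.1, init_mem k.2⟩

/-- The `(d+1)`-dimensional extension `F'` of the set `F` of forbidden patterns. -/
def extendPatterns {d : ℕ} {A : Type*} (F : Set (Pattern d A)) : Set (Pattern (d + 1) A) :=
  Pattern.extend '' F

/-- The restriction of a `(d+1)`-dimensional configuration to the layer `ℤ^d × {0}`. -/
def restrictLayer {d : ℕ} {A : Type*} (ω : Config (d + 1) A) : Config d A :=
  fun k => ω (baseCell k)

/-- The `d`-dimensional noise class induced by a `(d+1)`-dimensional one. -/
def restrictClass {d : ℕ} (N' : Set (Measure (Config (d + 1) (Fin 2)))) :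
    Set (Measure (Config d (Fin 2))) :=
  (fun ν => ν.map restrictLayer) '' N'

end

end NoisySFT

open NoisySFT

/-! The layers of a configuration of $\Omega_{\mathcal F'}$ do not interact, so the question is
whether measures on $\mathbb Z^d$ can be extended to $\mathbb Z^{d+1}$ compatibly with prescribed
data, and whether $d_B$ survives the passage.

The distance becomes local: for an invariant coupling, the integral of $d_H$ is the probability that
the components differ at the origin (`lintegral_dH`). Reverse Fatou gives one inequality; the other
is the upper half of the ergodic theorem along boxes, proved by a covering argument for one map and
by induction on the dimension for $\mathbb Z^d$. Thus the cost of a coupling on $\mathbb Z^{d+1}$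
only depends on its restriction to a layer.

The extension is `exists_lift`: let $\kappa$ be invariant on $\mathbb Z^d$, with a cellwise factor
that is the layer restriction of an invariant $\nu$ on $\mathbb Z^{d+1}$. Draw $b$ from $\nu$ and,
given $b$, fill the layers independently by the disintegration of $\kappa$ over that factor.
Equivariance of the disintegration makes the result invariant.

Lifting over the noise component shows that the noisy measures on $\mathbb Z^d$ are exactly the
restrictions of those on $\mathbb Z^{d+1}$. Lifting a coupling over its first component shows that
restriction preserves the distance to the measures of the SFT. Hence the two suprema agree for each
$\epsilon$. -/

/-! ### Upper ergodic inequality for one transformation -/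

/-- The limsup of Birkhoff averages does not decrease along the orbit. -/
theorem limsup_birkhoffSum_div_le_apply {Ω : Type*} {T : Ω → Ω} {f : Ω → ℝ≥0∞}
    (hf1 : ∀ ω, f ω ≤ 1) (ω : Ω) :
    limsup (fun n : ℕ => birkhoffSum T f n ω / n) atTop ≤
      limsup (fun n : ℕ => birkhoffSum T f n (T ω) / n) atTop := by
  calc limsup (fun n : ℕ => birkhoffSum T f n ω / n) atTop
      ≤ limsup ((fun n : ℕ => (n : ℝ≥0∞)⁻¹) + fun n : ℕ => birkhoffSum T f n (T ω) / n) atTop := by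
        -- No index is exceptional: at `n = 0` the added term `n⁻¹` is `∞`.
        refine limsup_le_limsup (Eventually.of_forall fun n => ?_)
        have : birkhoffSum T f n ω ≤ 1 + birkhoffSum T f n (T ω) := by
          calc birkhoffSum T f n ω ≤ birkhoffSum T f (n + 1) ω := by
                rw [birkhoffSum_succ]; exact le_self_add
            _ = f ω + birkhoffSum T f n (T ω) := birkhoffSum_succ' T f n ω
            _ ≤ _ := by gcongr; exact hf1 ω
        calc birkhoffSum T f n ω / n ≤ (1 + birkhoffSum T f n (T ω)) / n := by gcongr
          _ = _ := by simp [ENNReal.add_div]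
    _ = _ := ENNReal.limsup_add_of_left_tendsto_zero ENNReal.tendsto_inv_nat_nhds_zero _

/-- If from every point some block of length at most `M` has average at least `c - ε`,
then so do all long blocks, up to a boundary term. -/
theorem mul_le_birkhoffSum_of_blocks {Ω : Type*} {T : Ω → Ω} {g : Ω → ℝ≥0∞} {F : Ω → ℝ≥0∞}
    {c ε : ℝ≥0∞} {M : ℕ} (hF : ∀ ω, F ω ≤ F (T ω)) (hc : c ≤ 1)
    (hb : ∀ ω, c ≤ F ω → ∃ n : ℕ, 1 ≤ n ∧ n ≤ M ∧ n * c ≤ birkhoffSum T g n ω + n * ε)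
    (L : ℕ) (ω : Ω) (hω : c ≤ F ω) :
    L * c ≤ birkhoffSum T g L ω + L * ε + M := by
  induction L using Nat.strong_induction_on generalizing ω with
  | _ L ih =>
    rcases le_or_gt L M with hLM | hLM
    · calc (L : ℝ≥0∞) * c ≤ M * 1 := by gcongr
        _ ≤ _ := by rw [mul_one]; exact le_add_self
    · obtain ⟨n, hn1, hnM, hn⟩ := hb ω hω
      obtain ⟨m, rfl⟩ : ∃ m, L = n + m := ⟨L - n, by omega⟩
      -- Monotonicity of `F` along orbits keeps the threshold `c` valid where the first block ends,
      -- so that another block can start there.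
      have hiter : ∀ i, c ≤ F (T^[i] ω) := by
        intro i
        induction i with
        | zero => exact hω
        | succ i hi => rw [Function.iterate_succ_apply']; exact hi.trans (hF _)
      have := ih m (by omega) (T^[n] ω) (hiter n)
      rw [birkhoffSum_add]
      push_cast
      calc ((n : ℝ≥0∞) + m) * c = n * c + m * c := by ring
        _ ≤ (birkhoffSum T g n ω + n * ε) + (birkhoffSum T g m (T^[n] ω) + m * ε + M) := by
            gcongr
        _ = _ := by ring

theorem lintegral_birkhoffSum {Ω : Type*} [MeasurableSpace Ω] {μ : Measure Ω} {T : Ω → Ω}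
    (hT : MeasurePreserving T μ μ) {f : Ω → ℝ≥0∞} (hf : Measurable f) (n : ℕ) :
    ∫⁻ ω, birkhoffSum T f n ω ∂μ = n * ∫⁻ ω, f ω ∂μ := by
  simp only [birkhoffSum]
  rw [lintegral_finsetSum (f := fun i ω => f (T^[i] ω)) _
    fun i _ => hf.comp (hT.iterate i).measurable]
  rw [Finset.sum_congr rfl fun i _ => (hT.iterate i).lintegral_comp hf]
  simp

theorem measurable_birkhoffSum {Ω : Type*} [MeasurableSpace Ω] {T : Ω → Ω}
    (hT : Measurable T) {f : Ω → ℝ≥0∞} (hf : Measurable f) (n : ℕ) :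
    Measurable (birkhoffSum T f n) := by
  unfold birkhoffSum
  exact Finset.measurable_fun_sum _ fun i _ => hf.comp (hT.iterate i)

theorem birkhoffSum_div_le_one {Ω : Type*} {T : Ω → Ω} {f : Ω → ℝ≥0∞}
    (hf1 : ∀ ω, f ω ≤ 1) (n : ℕ) (ω : Ω) : birkhoffSum T f n ω / n ≤ 1 := by
  refine ENNReal.div_le_of_le_mul ?_
  rw [one_mul]
  calc birkhoffSum T f n ω ≤ ∑ _i ∈ Finset.range n, (1 : ℝ≥0∞) :=
        Finset.sum_le_sum fun i _ => hf1 _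
    _ = n := by simp

/-- The upper half of the pointwise ergodic theorem, for bounded functions. -/
theorem lintegral_limsup_birkhoffSum_le {Ω : Type*} [MeasurableSpace Ω] {μ : Measure Ω}
    [IsProbabilityMeasure μ] {T : Ω → Ω} (hT : MeasurePreserving T μ μ) {f : Ω → ℝ≥0∞}
    (hf : Measurable f) (hf1 : ∀ ω, f ω ≤ 1) :
    ∫⁻ ω, limsup (fun n : ℕ => birkhoffSum T f n ω / n) atTop ∂μ ≤ ∫⁻ ω, f ω ∂μ := by
  set F : Ω → ℝ≥0∞ := fun ω => limsup (fun n : ℕ => birkhoffSum T f n ω / n) atTop with hFdef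
  have hFm : Measurable F :=
    Measurable.limsup fun n => (measurable_birkhoffSum hT.measurable hf n).div_const _
  have hF1 : ∀ ω, F ω ≤ 1 := fun ω =>
    limsup_le_of_le (h := Eventually.of_forall fun n => birkhoffSum_div_le_one hf1 n ω)
  have key : ∀ ε : ℝ≥0, 0 < ε → ∫⁻ ω, F ω ∂μ ≤ ∫⁻ ω, f ω ∂μ + ε := by
    intro ε hε
    -- The points with a good block of length at most `M + 1`, that is, one whose average is within
    -- `ε` of the limsup. These sets increase to the whole space.
    set E : ℕ → Set Ω := fun M =>
      ⋃ n ∈ Finset.Icc 1 (M + 1), {ω | (n : ℝ≥0∞) * F ω ≤ birkhoffSum T f n ω + n * ε}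
    have hEm : ∀ M, MeasurableSet (E M) := fun M =>
      Finset.measurableSet_biUnion _ fun n _ => measurableSet_le (hFm.const_mul _)
        ((measurable_birkhoffSum hT.measurable hf n).add_const _)
    have hEmono : Monotone E := fun M M' h => Set.biUnion_subset_biUnion_left fun n hn => by
      rw [Finset.coe_Icc] at hn ⊢
      exact ⟨hn.1, hn.2.trans (by omega)⟩
    have hEu : ⋃ M, E M = Set.univ := by
      refine Set.eq_univ_of_forall fun ω => ?_
      rcases eq_or_ne (F ω) 0 with h0 | h0
      · exact Set.mem_iUnion.2 ⟨0, Set.mem_biUnion (x := 1) (by simp) (by simp [h0])⟩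
      · have hlt : F ω - ε < limsup (fun n : ℕ => birkhoffSum T f n ω / n) atTop :=
          ENNReal.sub_lt_self (ne_top_of_le_ne_top ENNReal.one_ne_top (hF1 ω)) h0
            (by simpa using hε.ne')
        obtain ⟨n, hn, hn1⟩ := ((frequently_lt_of_lt_limsup (by isBoundedDefault) hlt).and_eventually
          (eventually_ge_atTop 1)).exists
        refine Set.mem_iUnion.2 ⟨n, Set.mem_biUnion (x := n) (by simp [hn1]) ?_⟩
        have hn0 : (n : ℝ≥0∞) ≠ 0 := by exact_mod_cast (by omega : n ≠ 0)
        have h3 : F ω ≤ birkhoffSum T f n ω / n + ε := tsub_le_iff_right.1 hn.le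
        calc (n : ℝ≥0∞) * F ω ≤ n * (birkhoffSum T f n ω / n + ε) := by gcongr
          _ = _ := by
            rw [mul_add, ENNReal.mul_div_cancel hn0 (ENNReal.natCast_ne_top n)]
    have hM : ∀ M, ∫⁻ ω, F ω ∂μ ≤ ∫⁻ ω, f ω ∂μ + μ (E M)ᶜ + ε := by
      intro M
      -- Adding `1` on the bad set turns each bad point into a good block of length one, because `F
      -- ≤ 1`. The cost in the integral is the measure of the bad set.
      set g : Ω → ℝ≥0∞ := fun ω => f ω + (E M)ᶜ.indicator 1 ω
      have hgm : Measurable g := hf.add (measurable_one.indicator (hEm M).compl)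
      have hgint : ∫⁻ ω, g ω ∂μ = ∫⁻ ω, f ω ∂μ + μ (E M)ᶜ := by
        rw [lintegral_add_left hf, lintegral_indicator_one (hEm M).compl]
      have hfg : ∀ n ω, birkhoffSum T f n ω ≤ birkhoffSum T g n ω := fun n ω =>
        Finset.sum_le_sum fun i _ => le_self_add
      have hpt : ∀ (L : ℕ) ω, L * F ω ≤ birkhoffSum T g L ω + L * ε + (M + 1 : ℕ) := by
        intro L ω
        -- The threshold is frozen at the value of `F` at the starting point.
        refine mul_le_birkhoffSum_of_blocks (F := F) (limsup_birkhoffSum_div_le_apply hf1)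
          (hF1 ω) ?_ L ω le_rfl
        intro ω' hω'
        by_cases hE : ω' ∈ E M
        · obtain ⟨n, hn, hn'⟩ := Set.mem_iUnion₂.1 hE
          rw [Finset.mem_Icc] at hn
          exact ⟨n, hn.1, hn.2, (by gcongr : (n : ℝ≥0∞) * F ω ≤ n * F ω').trans
            (le_trans hn' (by gcongr; exact hfg n ω'))⟩
        · refine ⟨1, le_rfl, by omega, ?_⟩
          have : 1 ≤ g ω' := by simp [g, hE]
          simpa using ((hF1 ω).trans this).trans le_self_add
      -- Integration and division by the length leave a boundary term that vanishes as `L → ∞`;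
      -- afterwards `M → ∞` removes the bad set.
      have hL : ∀ L : ℕ, ∫⁻ ω, F ω ∂μ ≤
          (∫⁻ ω, f ω ∂μ + μ (E M)ᶜ + ε) + (M + 1 : ℕ) / ((L + 1 : ℕ) : ℝ≥0∞) := by
        intro L
        have h1 := lintegral_mono (μ := μ) (hpt (L + 1))
        rw [lintegral_const_mul _ hFm, lintegral_add_right _ measurable_const,
          lintegral_add_right _ measurable_const, lintegral_birkhoffSum hT hgm, hgint,
          lintegral_const, lintegral_const, measure_univ, mul_one, mul_one] at h1
        have hL0 : ((L + 1 : ℕ) : ℝ≥0∞) ≠ 0 := by exact_mod_cast Nat.succ_ne_zero L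
        have hLt : ((L + 1 : ℕ) : ℝ≥0∞) ≠ ∞ := ENNReal.natCast_ne_top _
        refine (ENNReal.mul_le_mul_iff_right hL0 hLt).1 (h1.trans_eq ?_)
        rw [mul_add _ _ (((M + 1 : ℕ) : ℝ≥0∞) / _), ENNReal.mul_div_cancel hL0 hLt]
        ring
      have hlim : Tendsto (fun L : ℕ => (∫⁻ ω, f ω ∂μ + μ (E M)ᶜ + ε) +
          (M + 1 : ℕ) / ((L + 1 : ℕ) : ℝ≥0∞)) atTop
          (𝓝 ((∫⁻ ω, f ω ∂μ + μ (E M)ᶜ + ε) + 0)) := by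
        refine tendsto_const_nhds.add ?_
        exact (ENNReal.Tendsto.const_div ENNReal.tendsto_nat_nhds_top
          (Or.inr (ENNReal.natCast_ne_top _)) |>.comp (tendsto_add_atTop_nat 1)).trans
            (by simp)
      rw [add_zero] at hlim
      exact ge_of_tendsto' hlim hL
    have hEc : Tendsto (fun M => μ (E M)ᶜ) atTop (𝓝 0) := by
      have := tendsto_measure_iInter_atTop (μ := μ) (s := fun M => (E M)ᶜ)
        (fun M => (hEm M).compl.nullMeasurableSet)
        (fun M M' h => Set.compl_subset_compl.2 (hEmono h)) ⟨0, measure_ne_top _ _⟩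
      rwa [← Set.compl_iUnion, hEu, Set.compl_univ, measure_empty] at this
    have := (tendsto_const_nhds (x := ∫⁻ ω, f ω ∂μ)).add hEc |>.add_const (ε : ℝ≥0∞)
    rw [add_zero] at this
    exact ge_of_tendsto' this hM
  exact ENNReal.le_of_forall_pos_le_add fun ε hε _ => key ε hε

/-! ### Upper ergodic inequality for actions of ℤ and ℤ^d -/

theorem ENNReal.limsup_add_le_add {ι : Type*} {l : Filter ι} (u v : ι → ℝ≥0∞) :
    limsup (u + v) l ≤ limsup u l + limsup v l := by
  refine le_of_forall_gt fun c hc => ?_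
  obtain ⟨a, ha, b, hb, hab⟩ := ENNReal.exists_add_lt_of_add_lt hc
  refine lt_of_le_of_lt (limsup_le_of_le (by isBoundedDefault) ?_) hab
  filter_upwards [eventually_lt_of_limsup_lt ha, eventually_lt_of_limsup_lt hb] with i hi hi'
  exact add_le_add hi.le hi'.le

/-- A measure-preserving action of an additive monoid by measurable maps. -/
structure PreservingAction {G Ω : Type*} [AddMonoid G] [MeasurableSpace Ω] (φ : G → Ω → Ω)
    (μ : Measure Ω) : Prop where
  zero : φ 0 = id
  add : ∀ g h, φ (g + h) = φ g ∘ φ h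
  preserving : ∀ g, MeasurePreserving (φ g) μ μ

theorem PreservingAction.comp {G H Ω : Type*} [AddMonoid G] [AddMonoid H] [MeasurableSpace Ω]
    {φ : G → Ω → Ω} {μ : Measure Ω} (hφ : PreservingAction φ μ) (e : H →+ G) :
    PreservingAction (fun h => φ (e h)) μ where
  zero := by rw [map_zero, hφ.zero]
  add g h := by rw [map_add, hφ.add]
  preserving g := hφ.preserving _

theorem PreservingAction.iterate {G Ω : Type*} [AddMonoid G] [MeasurableSpace Ω]
    {φ : G → Ω → Ω} {μ : Measure Ω} (hφ : PreservingAction φ μ) (g : G) (n : ℕ) :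
    (φ g)^[n] = φ (n • g) := by
  induction n with
  | zero => rw [zero_smul, hφ.zero, Function.iterate_zero]
  | succ n ih => rw [Function.iterate_succ, ih, succ_nsmul, hφ.add]

theorem sum_Icc_neg_add (u : ℤ → ℝ≥0∞) (n : ℕ) :
    ∑ j ∈ Finset.Icc (-(n : ℤ)) n, u j + u 0 =
      ∑ i ∈ Finset.range (n + 1), u i + ∑ i ∈ Finset.range (n + 1), u (-i) := by
  induction n with
  | zero => simp
  | succ n ih =>
    have hI : Finset.Icc (-((n + 1 : ℕ) : ℤ)) ((n + 1 : ℕ) : ℤ) =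
        insert (-((n + 1 : ℕ) : ℤ)) (insert ((n + 1 : ℕ) : ℤ) (Finset.Icc (-(n : ℤ)) n)) := by
      ext j; simp only [Finset.mem_Icc, Finset.mem_insert]; omega
    rw [hI, Finset.sum_insert (by simp; omega), Finset.sum_insert (by simp), add_assoc,
      add_assoc, ih, Finset.sum_range_succ _ (n + 1), Finset.sum_range_succ _ (n + 1)]
    ring

/-- A symmetric sum is bounded by two one-sided sums and a boundary term. -/
theorem sum_Icc_neg_le {u : ℤ → ℝ≥0∞} (hu : ∀ j, u j ≤ 1) (n : ℕ) :
    ∑ j ∈ Finset.Icc (-(n : ℤ)) n, u j ≤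
      ∑ i ∈ Finset.range n, u i + ∑ i ∈ Finset.range n, u (-i) + 2 := by
  calc ∑ j ∈ Finset.Icc (-(n : ℤ)) n, u j ≤ ∑ j ∈ Finset.Icc (-(n : ℤ)) n, u j + u 0 :=
        le_self_add
    _ = (∑ i ∈ Finset.range n, u i + u n) + (∑ i ∈ Finset.range n, u (-i) + u (-n)) := by
        rw [sum_Icc_neg_add, Finset.sum_range_succ, Finset.sum_range_succ]
    _ ≤ (∑ i ∈ Finset.range n, u i + 1) + (∑ i ∈ Finset.range n, u (-i) + 1) := by
        gcongr <;> exact hu _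
    _ = _ := by ring

/-- A two-sided average is, up to a term of order `1/n`, at most the mean of the Birkhoff averages
of `φ 1` and `φ (-1)`, and each of these obeys the one-sided inequality. -/
theorem lintegral_limsup_sum_Icc_le {Ω : Type*} [MeasurableSpace Ω] {μ : Measure Ω}
    [IsProbabilityMeasure μ] {φ : ℤ → Ω → Ω} (hφ : PreservingAction φ μ) {f : Ω → ℝ≥0∞}
    (hf : Measurable f) (hf1 : ∀ ω, f ω ≤ 1) :
    ∫⁻ ω, limsup (fun n : ℕ => (∑ j ∈ Finset.Icc (-(n : ℤ)) n, f (φ j ω)) / (2 * n + 1 : ℕ))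
      atTop ∂μ ≤ ∫⁻ ω, f ω ∂μ := by
  have hb : ∀ (j : ℤ) (n : ℕ) ω,
      birkhoffSum (φ j) f n ω = ∑ i ∈ Finset.range n, f (φ (i * j) ω) := by
    intro j n ω
    simp [birkhoffSum, hφ.iterate]
  set B : ℤ → Ω → ℝ≥0∞ := fun j ω => limsup (fun n : ℕ => birkhoffSum (φ j) f n ω / n) atTop
  have hBm : ∀ j, Measurable (B j) := fun j =>
    Measurable.limsup fun n =>
      (measurable_birkhoffSum (hφ.preserving j).measurable hf n).div_const _
  have hpt : ∀ ω, limsup (fun n : ℕ =>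
      (∑ j ∈ Finset.Icc (-(n : ℤ)) n, f (φ j ω)) / (2 * n + 1 : ℕ)) atTop ≤
      2⁻¹ * (B 1 ω + B (-1) ω) := by
    intro ω
    have h2 : (2⁻¹ : ℝ≥0∞) ≠ ∞ := by simp
    calc limsup (fun n : ℕ =>
          (∑ j ∈ Finset.Icc (-(n : ℤ)) n, f (φ j ω)) / (2 * n + 1 : ℕ)) atTop
        ≤ limsup ((fun n : ℕ => (n : ℝ≥0∞)⁻¹) + fun n : ℕ =>
          2⁻¹ * (birkhoffSum (φ 1) f n ω / n + birkhoffSum (φ (-1)) f n ω / n)) atTop := by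
          refine limsup_le_limsup (Eventually.of_forall fun n => ?_)
          calc (∑ j ∈ Finset.Icc (-(n : ℤ)) n, f (φ j ω)) / (2 * n + 1 : ℕ)
              ≤ (birkhoffSum (φ 1) f n ω + birkhoffSum (φ (-1)) f n ω + 2) / (2 * n) := by
                refine ENNReal.div_le_div ?_ (by push_cast; exact le_self_add)
                have := sum_Icc_neg_le (u := fun j => f (φ j ω)) (fun j => hf1 _) n
                simpa [hb] using this
            _ = _ := by
                simp only [Pi.add_apply, div_eq_mul_inv]
                rw [ENNReal.mul_inv (by simp) (by simp)]
                have : (2 : ℝ≥0∞) * 2⁻¹ = 1 := ENNReal.mul_inv_cancel (by simp) (by simp)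
                calc _ = 2 * 2⁻¹ * (n : ℝ≥0∞)⁻¹ + 2⁻¹ *
                      (birkhoffSum (φ 1) f n ω * (n : ℝ≥0∞)⁻¹ +
                        birkhoffSum (φ (-1)) f n ω * (n : ℝ≥0∞)⁻¹) := by ring
                  _ = _ := by rw [this, one_mul]
      _ = 2⁻¹ * limsup ((fun n : ℕ => birkhoffSum (φ 1) f n ω / n) +
            fun n : ℕ => birkhoffSum (φ (-1)) f n ω / n) atTop := by
          rw [ENNReal.limsup_add_of_left_tendsto_zero ENNReal.tendsto_inv_nat_nhds_zero,
            ENNReal.limsup_const_mul_of_ne_top h2]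
          rfl
      _ ≤ _ := by gcongr; exact ENNReal.limsup_add_le_add _ _
  calc _ ≤ ∫⁻ ω, 2⁻¹ * (B 1 ω + B (-1) ω) ∂μ := lintegral_mono hpt
    _ = 2⁻¹ * (∫⁻ ω, B 1 ω ∂μ + ∫⁻ ω, B (-1) ω ∂μ) := by
        rw [lintegral_const_mul (f := fun ω => B 1 ω + B (-1) ω) _ ((hBm 1).add (hBm (-1))),
          lintegral_add_left (hBm 1)]
    _ ≤ 2⁻¹ * (∫⁻ ω, f ω ∂μ + ∫⁻ ω, f ω ∂μ) := by
        exact mul_le_mul_right (add_le_add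
          (lintegral_limsup_birkhoffSum_le (hφ.preserving _) hf hf1)
          (lintegral_limsup_birkhoffSum_le (hφ.preserving _) hf hf1)) _
    _ = _ := by
        rw [← two_mul, ← mul_assoc, ENNReal.inv_mul_cancel (by simp) (by simp), one_mul]

theorem NoisySFT.card_box (d n : ℕ) : (box d n).card = (2 * n + 1) ^ d := by
  rw [box, Pi.card_Icc]
  simp
  congr 1
  omega

theorem NoisySFT.sum_box_succ {d : ℕ} (n : ℕ) (u : (Fin (d + 1) → ℤ) → ℝ≥0∞) :
    ∑ k ∈ box (d + 1) n, u k =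
      ∑ j ∈ Finset.Icc (-(n : ℤ)) n, ∑ k ∈ box d n, u (Fin.cons (α := fun _ => ℤ) j k) := by
  rw [← Finset.sum_product']
  symm
  refine Finset.sum_bij' (fun p _ => Fin.cons (α := fun _ => ℤ) p.1 p.2)
    (fun k _ => (k 0, Fin.tail k)) ?_ ?_ ?_ ?_ ?_
  · rintro ⟨j, k⟩ h
    simp only [box, Finset.mem_product, Finset.mem_Icc, Pi.le_def] at h ⊢
    constructor <;> intro i <;> refine Fin.cases ?_ (fun i => ?_) i <;> simp [h]
  · intro k h
    simp only [box, Finset.mem_product, Finset.mem_Icc, Pi.le_def] at h ⊢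
    exact ⟨⟨h.1 0, h.2 0⟩, fun i => h.1 i.succ, fun i => h.2 i.succ⟩
  · rintro ⟨j, k⟩ h; simp
  · intro k h; simp
  · rintro ⟨j, k⟩ h; rfl

/-- The average over the box `B_n` of a function along an action of `ℤ^d`. -/
noncomputable def boxAverage {d : ℕ} {Ω : Type*} (φ : (Fin d → ℤ) → Ω → Ω) (f : Ω → ℝ≥0∞)
    (n : ℕ) (ω : Ω) : ℝ≥0∞ :=
  (∑ k ∈ box d n, f (φ k ω)) / (box d n).card

theorem boxAverage_le_one {d : ℕ} {Ω : Type*} {φ : (Fin d → ℤ) → Ω → Ω} {f : Ω → ℝ≥0∞}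
    (hf1 : ∀ ω, f ω ≤ 1) (n : ℕ) (ω : Ω) : boxAverage φ f n ω ≤ 1 := by
  refine ENNReal.div_le_of_le_mul ?_
  rw [one_mul]
  calc ∑ k ∈ box d n, f (φ k ω) ≤ ∑ _k ∈ box d n, (1 : ℝ≥0∞) :=
        Finset.sum_le_sum fun i _ => hf1 _
    _ = _ := by simp

theorem measurable_boxAverage {d : ℕ} {Ω : Type*} [MeasurableSpace Ω] {φ : (Fin d → ℤ) → Ω → Ω}
    (hφ : ∀ k, Measurable (φ k)) {f : Ω → ℝ≥0∞} (hf : Measurable f) (n : ℕ) :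
    Measurable (boxAverage φ f n) :=
  (Finset.measurable_fun_sum _ fun k _ => hf.comp (hφ k)).div_const _

/-- The inclusion of the first axis in `ℤ^{d+1}`. -/
def firstAxis (d : ℕ) : ℤ →+ (Fin (d + 1) → ℤ) where
  toFun j := Fin.cons (α := fun _ => ℤ) j 0
  map_zero' := by ext i; refine Fin.cases ?_ (fun i => ?_) i <;> simp
  map_add' a b := by ext i; refine Fin.cases ?_ (fun i => ?_) i <;> simp

/-- The inclusion of the last `d` axes in `ℤ^{d+1}`. -/
def lastAxes (d : ℕ) : (Fin d → ℤ) →+ (Fin (d + 1) → ℤ) where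
  toFun k := Fin.cons (α := fun _ => ℤ) 0 k
  map_zero' := by ext i; refine Fin.cases ?_ (fun i => ?_) i <;> simp
  map_add' a b := by ext i; refine Fin.cases ?_ (fun i => ?_) i <;> simp

theorem cons_eq_lastAxes_add_firstAxis {d : ℕ} (j : ℤ) (k : Fin d → ℤ) :
    Fin.cons (α := fun _ => ℤ) j k = lastAxes d k + firstAxis d j := by
  ext i; refine Fin.cases ?_ (fun i => ?_) i <;> simp [firstAxis, lastAxes]

theorem boxAverage_succ {d : ℕ} {Ω : Type*} [MeasurableSpace Ω] {μ : Measure Ω}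
    {φ : (Fin (d + 1) → ℤ) → Ω → Ω} (hφ : PreservingAction φ μ) (f : Ω → ℝ≥0∞) (n : ℕ) (ω : Ω) :
    boxAverage φ f n ω =
      (∑ j ∈ Finset.Icc (-(n : ℤ)) n, boxAverage (fun k => φ (lastAxes d k)) f n
        (φ (firstAxis d j) ω)) / (2 * n + 1 : ℕ) := by
  simp only [boxAverage, sum_box_succ, card_box, cons_eq_lastAxes_add_firstAxis, hφ.add,
    Function.comp_apply, div_eq_mul_inv]
  rw [← Finset.sum_mul, mul_assoc]
  congr 1
  push_cast
  rw [pow_succ, ENNReal.mul_inv (Or.inr (by simp [ENNReal.mul_eq_top])) (Or.inr (by simp))]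

/-- The upper half of the pointwise ergodic theorem for actions of `ℤ^d` along boxes. -/
theorem lintegral_limsup_boxAverage_le {d : ℕ} {Ω : Type*} [MeasurableSpace Ω] {μ : Measure Ω}
    [IsProbabilityMeasure μ] {φ : (Fin d → ℤ) → Ω → Ω} (hφ : PreservingAction φ μ)
    {f : Ω → ℝ≥0∞} (hf : Measurable f) (hf1 : ∀ ω, f ω ≤ 1) :
    ∫⁻ ω, limsup (fun n => boxAverage φ f n ω) atTop ∂μ ≤ ∫⁻ ω, f ω ∂μ := by
  induction d with
  | zero =>
    have : ∀ n ω, boxAverage φ f n ω = f ω := by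
      intro n ω
      have h0 : box 0 n = {0} := by ext k; simp [box, Subsingleton.elim k 0]
      rw [boxAverage, h0, Finset.sum_singleton, hφ.zero]
      simp
    simp [this]
  | succ d ih =>
    set g : ℕ → Ω → ℝ≥0∞ := boxAverage (fun k => φ (lastAxes d k)) f
    have hgm : ∀ n, Measurable (g n) :=
      measurable_boxAverage (fun k => (hφ.preserving _).measurable) hf
    -- The inner averages vary with `n`, whereas the one-dimensional inequality needs a fixed
    -- function. The supremum over `n ≥ N` dominates them all from `N` on.
    set h : ℕ → Ω → ℝ≥0∞ := fun N ω => ⨆ n ≥ N, g n ω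
    have hhm : ∀ N, Measurable (h N) := fun N =>
      Measurable.iSup fun n => Measurable.iSup fun _ => hgm n
    have hh1 : ∀ N ω, h N ω ≤ 1 := fun N ω => iSup₂_le fun n _ => boxAverage_le_one hf1 n ω
    have hN : ∀ N, ∫⁻ ω, limsup (fun n => boxAverage φ f n ω) atTop ∂μ ≤ ∫⁻ ω, h N ω ∂μ := by
      intro N
      refine le_trans (lintegral_mono fun ω => ?_)
        (lintegral_limsup_sum_Icc_le (hφ.comp (firstAxis d)) (hhm N) (hh1 N))
      refine limsup_le_limsup ?_
      filter_upwards [eventually_ge_atTop N] with n hn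
      rw [boxAverage_succ hφ]
      gcongr with j hj
      exact le_iSup₂ (f := fun n (_ : n ≥ N) => g n (φ (firstAxis d j) ω)) n hn
    -- As `N` grows, `h N` decreases to the limsup of the `d`-dimensional averages; monotone
    -- convergence then reduces to the induction hypothesis.
    calc _ ≤ ⨅ N, ∫⁻ ω, h N ω ∂μ := le_iInf hN
      _ = ∫⁻ ω, ⨅ N, h N ω ∂μ := by
          refine (lintegral_iInf hhm ?_ ?_).symm
          · exact fun N N' hNN' ω => biSup_mono fun n hn => le_trans hNN' hn
          · refine ne_top_of_le_ne_top ENNReal.one_ne_top ((lintegral_mono (hh1 0)).trans ?_)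
            simp
      _ = ∫⁻ ω, limsup (fun n => g n ω) atTop ∂μ := by
          simp only [limsup_eq_iInf_iSup_of_nat, h]
      _ ≤ _ := ih (hφ.comp (lastAxes d))

/-! ### The Besicovitch distance as a probability of disagreement -/

namespace NoisySFT

theorem measurable_shift {d : ℕ} {A : Type*} [MeasurableSpace A] (k : Fin d → ℤ) :
    Measurable (shift (A := A) k) :=
  measurable_pi_lambda _ fun l => measurable_pi_apply (k + l)

theorem shift_zero {d : ℕ} {A : Type*} : shift (A := A) (0 : Fin d → ℤ) = id := by
  ext ω l; simp [shift]

theorem shift_add {d : ℕ} {A : Type*} (k l : Fin d → ℤ) :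
    shift (A := A) (k + l) = shift k ∘ shift l := by
  ext ω m; simp [shift, add_left_comm, add_comm]

theorem preservingAction_shift {d : ℕ} {A : Type*} [MeasurableSpace A]
    {μ : Measure (Config d A)} (hμ : μ ∈ invMeasures d A) : PreservingAction shift μ where
  zero := shift_zero
  add := shift_add
  preserving k := ⟨measurable_shift k, hμ.2 k⟩

/-- The image of a configuration by a map of alphabets, applied cell by cell. -/
def mapCells {d : ℕ} {A B : Type*} (π : A → B) (ω : Config d A) : Config d B := fun k => π (ω k)

theorem measurable_mapCells {d : ℕ} {A B : Type*} [MeasurableSpace A] [MeasurableSpace B]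
    {π : A → B} (hπ : Measurable π) : Measurable (mapCells (d := d) π) :=
  measurable_pi_lambda _ fun k => hπ.comp (measurable_pi_apply k)

theorem mapCells_shift {d : ℕ} {A B : Type*} (π : A → B) (k : Fin d → ℤ) :
    mapCells π ∘ shift k = shift k ∘ mapCells π := rfl

theorem map_mapCells_mem_invMeasures {d : ℕ} {A B : Type*} [MeasurableSpace A]
    [MeasurableSpace B] {π : A → B} (hπ : Measurable π) {μ : Measure (Config d A)}
    (hμ : μ ∈ invMeasures d A) : μ.map (mapCells π) ∈ invMeasures d B := by
  obtain ⟨h1, h2⟩ := hμ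
  refine ⟨Measure.isProbabilityMeasure_map (measurable_mapCells hπ).aemeasurable, fun k => ?_⟩
  rw [Measure.map_map (measurable_shift k) (measurable_mapCells hπ), ← mapCells_shift,
    ← Measure.map_map (measurable_mapCells hπ) (measurable_shift k), h2]

theorem projFst_eq_mapCells {d : ℕ} {A B : Type*} :
    (projFst : Config d (A × B) → Config d A) = mapCells Prod.fst := rfl

theorem projSnd_eq_mapCells {d : ℕ} {A B : Type*} :
    (projSnd : Config d (A × B) → Config d B) = mapCells Prod.snd := rfl

/-- The event that the two components differ at the origin. -/
def diffAtZero (d : ℕ) (A : Type*) : Set (Config d (A × A)) := {z | (z 0).1 ≠ (z 0).2}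

theorem measurableSet_diffAtZero {d : ℕ} {A : Type*} [Countable A] [MeasurableSpace A]
    [DiscreteMeasurableSpace A] : MeasurableSet (diffAtZero d A) :=
  measurable_pi_apply (X := fun _ => A × A) (0 : Fin d → ℤ)
    (MeasurableSet.of_discrete (s := {p : A × A | p.1 ≠ p.2}))

theorem hamming_proj_eq_boxAverage {d : ℕ} {A : Type*} (n : ℕ) (z : Config d (A × A)) :
    hamming (box d n) (projFst z) (projSnd z) =
      boxAverage shift ((diffAtZero d A).indicator 1) n z := by
  classical
  simp only [hamming, boxAverage, Set.indicator_apply, Pi.one_apply]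
  rw [Finset.sum_boole]
  simp only [diffAtZero, Set.mem_ofPred_eq, shift, add_zero, projFst, projSnd]
  congr!

/-- For a shift-invariant measure on pairs, the mean Hamming-Besicovitch distance is the
probability that the components differ at the origin. -/
theorem lintegral_dH {d : ℕ} {A : Type*} [Countable A] [MeasurableSpace A]
    [DiscreteMeasurableSpace A] {l : Measure (Config d (A × A))}
    (hl : l ∈ invMeasures d (A × A)) :
    ∫⁻ z, dH (projFst z) (projSnd z) ∂l = l (diffAtZero d A) := by
  have := hl.1
  have hφ := preservingAction_shift hl
  set f : Config d (A × A) → ℝ≥0∞ := (diffAtZero d A).indicator 1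
  have hf : Measurable f := measurable_one.indicator measurableSet_diffAtZero
  have hf1 : ∀ z, f z ≤ 1 := fun z => Set.indicator_le_self' (by simp) z
  have hint : ∫⁻ z, f z ∂l = l (diffAtZero d A) :=
    lintegral_indicator_one measurableSet_diffAtZero
  have hav : ∀ n, ∫⁻ z, boxAverage shift f n z ∂l = l (diffAtZero d A) := by
    intro n
    have hc : ((box d n).card : ℝ≥0∞) ≠ 0 := by
      rw [card_box]; positivity
    simp only [boxAverage, div_eq_mul_inv]
    rw [lintegral_mul_const (f := fun z => ∑ k ∈ box d n, f (shift k z)) _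
        (Finset.measurable_fun_sum _ fun k _ => hf.comp (measurable_shift k)),
      lintegral_finsetSum (f := fun k z => f (shift k z)) _
        fun k _ => hf.comp (measurable_shift k),
      Finset.sum_congr rfl fun k _ => (hφ.preserving k).lintegral_comp hf, hint,
      Finset.sum_const, nsmul_eq_mul, mul_comm, ← mul_assoc,
      ENNReal.inv_mul_cancel hc (ENNReal.natCast_ne_top _), one_mul]
  simp only [dH, hamming_proj_eq_boxAverage]
  refine le_antisymm ((lintegral_limsup_boxAverage_le hφ hf hf1).trans_eq hint) ?_
  -- Reverse Fatou, with dominating function `1`: every box average has the same integral by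
  -- invariance.
  have h := limsup_lintegral_le (μ := l) (f := boxAverage shift f) 1
    (measurable_boxAverage measurable_shift hf)
    (fun n => Eventually.of_forall fun z => boxAverage_le_one hf1 n z) (by simp)
  simpa [hav] using h

theorem dB_eq {d : ℕ} {A : Type*} [Countable A] [MeasurableSpace A]
    [DiscreteMeasurableSpace A] (μ ν : Measure (Config d A)) :
    dB μ ν = ⨅ l ∈ couplings μ ν, l (diffAtZero d A) :=
  iInf_congr fun _ => iInf_congr fun hl => lintegral_dH hl.1

end NoisySFT

/-! ### Mixtures of measures and infinite products -/

namespace MeasureTheory.Measure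

variable {α β γ : Type*} [MeasurableSpace α] [MeasurableSpace β] [MeasurableSpace γ]

theorem map_bind_eq {μ : Measure α} {m : α → Measure β} (hm : Measurable m) {g : β → γ}
    (hg : Measurable g) : (μ.bind m).map g = μ.bind fun a => (m a).map g := by
  ext s hs
  have hm' : Measurable fun a => (m a).map g := (Measure.measurable_map g hg).comp hm
  rw [map_apply hg hs, bind_apply (hg hs) hm.aemeasurable, bind_apply hs hm'.aemeasurable]
  simp only [map_apply hg hs]

theorem bind_map_eq {μ : Measure α} {g : α → β} (hg : Measurable g) {m : β → Measure γ}
    (hm : Measurable m) : (μ.map g).bind m = μ.bind fun a => m (g a) := by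
  ext s hs
  rw [bind_apply hs hm.aemeasurable, bind_apply hs (f := fun a => m (g a)) (hm.comp hg).aemeasurable]
  exact lintegral_map ((measurable_coe hs).comp hm) hg

theorem bind_congr_ae {μ : Measure α} {m m' : α → Measure β} (hm : Measurable m)
    (hm' : Measurable m') (h : ∀ᵐ a ∂μ, m a = m' a) : μ.bind m = μ.bind m' := by
  ext s hs
  rw [bind_apply hs hm.aemeasurable, bind_apply hs hm'.aemeasurable]
  exact lintegral_congr_ae (h.mono fun a ha => by simp only [ha])

theorem infinitePi_map_reindex {ι ι' X : Type*} [MeasurableSpace X] (e : ι' ≃ ι)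
    (μ : ι → Measure X) [∀ i, IsProbabilityMeasure (μ i)] :
    (infinitePi μ).map (fun x i => x (e i)) = infinitePi fun i => μ (e i) := by
  refine eq_infinitePi _ fun s t ht => ?_
  have hpre : (fun (x : ι → X) i => x (e i)) ⁻¹' (Set.pi s t) =
      Set.pi (s.map e.toEmbedding) fun j => t (e.symm j) := by
    ext x; simp [Set.mem_pi, e.forall_congr_left]
  rw [map_apply (by fun_prop) (.pi s.countable_toSet fun _ _ => ht _), hpre,
    infinitePi_pi _ fun i _ => ht _]
  simp

/-- Square cylinders form a generating π-system, and on each of them the product measure is a finite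
product of measurable functions of the parameter. -/
theorem measurable_infinitePi {ι X : Type*} [MeasurableSpace X] {m : α → ι → Measure X}
    [∀ a i, IsProbabilityMeasure (m a i)] (hm : ∀ i, Measurable fun a => m a i) :
    Measurable fun a => infinitePi (m a) := by
  refine Measurable.measure_of_isPiSystem_of_isProbabilityMeasure
    generateFrom_squareCylinders.symm
    (isPiSystem_squareCylinders (fun _ => MeasurableSpace.isPiSystem_measurableSet)
      fun _ => MeasurableSet.univ) ?_
  rintro _ ⟨s, t, ht, rfl⟩
  have ht' : ∀ i, MeasurableSet (t i) := fun i => ht i (Set.mem_univ i)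
  simp only [infinitePi_pi _ fun i _ => ht' i]
  exact Finset.measurable_fun_prod _ fun i _ => (measurable_coe (ht' i)).comp (hm i)

end MeasureTheory.Measure

/-! ### Layers of configurations on ℤ^{d+1} -/

namespace NoisySFT

open ProbabilityTheory

section Layers

variable {d : ℕ} {A : Type*}

/-- The layer of height `i`. -/
def layer (i : ℤ) (ω : Config (d + 1) A) : Config d A :=
  fun k => ω (Fin.snoc (α := fun _ => ℤ) k i)

/-- The configuration with prescribed layers. -/
def glue (y : ℤ → Config d A) : Config (d + 1) A :=
  fun k => y (k (Fin.last d)) (Fin.init (α := fun _ => ℤ) k)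

theorem layer_zero : layer (A := A) (d := d) 0 = restrictLayer := rfl

theorem glue_layer (ω : Config (d + 1) A) : (glue fun i => layer i ω) = ω := by
  ext k; simp [glue, layer, Fin.snoc_init_self]

theorem layer_glue (i : ℤ) (y : ℤ → Config d A) : layer i (glue y) = y i := by
  ext k; simp [glue, layer]

theorem layer_shift (i : ℤ) (k : Fin (d + 1) → ℤ) (ω : Config (d + 1) A) :
    layer i (shift k ω) =
      shift (Fin.init (α := fun _ => ℤ) k) (layer (k (Fin.last d) + i) ω) := by
  ext l
  simp only [layer, shift]
  congr 1
  ext j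
  refine Fin.lastCases ?_ (fun j => ?_) j <;> simp [Fin.init]

theorem restrictLayer_shift_baseCell (k : Fin d → ℤ) (ω : Config (d + 1) A) :
    restrictLayer (shift (baseCell k) ω) = shift k (restrictLayer ω) := by
  rw [← layer_zero, layer_shift, init_baseCell]
  simp [baseCell]

theorem layer_eq_restrictLayer_shift (i : ℤ) (ω : Config (d + 1) A) :
    layer i ω = restrictLayer (shift (Fin.snoc (α := fun _ => ℤ) 0 i) ω) := by
  rw [← layer_zero, layer_shift]
  simp [shift_zero]

variable [MeasurableSpace A]

theorem measurable_layer (i : ℤ) : Measurable (layer (A := A) (d := d) i) :=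
  measurable_pi_lambda _ fun _ => measurable_pi_apply _

theorem measurable_restrictLayer : Measurable (restrictLayer (A := A) (d := d)) :=
  measurable_layer 0

theorem measurable_glue : Measurable (glue (A := A) (d := d)) :=
  measurable_pi_lambda _ fun k =>
    (measurable_pi_apply (Fin.init (α := fun _ => ℤ) k)).comp
      (measurable_pi_apply (X := fun _ : ℤ => Config d A) (k (Fin.last d)))

theorem map_restrictLayer_mem_invMeasures {μ : Measure (Config (d + 1) A)}
    (hμ : μ ∈ invMeasures (d + 1) A) : μ.map restrictLayer ∈ invMeasures d A := by
  have := hμ.1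
  refine ⟨Measure.isProbabilityMeasure_map measurable_restrictLayer.aemeasurable, fun k => ?_⟩
  rw [Measure.map_map (measurable_shift k) measurable_restrictLayer]
  conv_rhs => rw [← hμ.2 (baseCell k),
    Measure.map_map measurable_restrictLayer (measurable_shift _)]
  congr 1
  ext1 ω
  exact (restrictLayer_shift_baseCell k ω).symm

theorem map_layer {μ : Measure (Config (d + 1) A)} (hμ : μ ∈ invMeasures (d + 1) A) (i : ℤ) :
    μ.map (layer i) = μ.map restrictLayer := by
  conv_rhs => rw [← hμ.2 (Fin.snoc (α := fun _ => ℤ) 0 i),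
    Measure.map_map measurable_restrictLayer (measurable_shift _)]
  congr 1
  ext1 ω
  exact layer_eq_restrictLayer_shift i ω

/-- Vertical invariance gives all layers the same law, and there are countably many of them. -/
theorem ae_forall_layer {μ : Measure (Config (d + 1) A)} (hμ : μ ∈ invMeasures (d + 1) A)
    {p : Config d A → Prop} (hp : ∀ᵐ ω ∂μ.map restrictLayer, p ω) :
    ∀ᵐ ω ∂μ, ∀ i, p (layer i ω) := by
  rw [ae_all_iff]
  intro i
  rw [← map_layer hμ i] at hp
  exact ae_of_ae_map (measurable_layer i).aemeasurable hp

end Layers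

/-! ### Lifting by conditionally independent layers -/

section Disintegration

variable {d : ℕ} {E B : Type*} [MeasurableSpace E] [MeasurableSpace B]

/-- Given `b`, the layers are drawn independently, the `i`-th one according to `K` at the `i`-th
layer of `b`. -/
noncomputable def independentLayers (K : Kernel (Config d B) (Config d E))
    (b : Config (d + 1) B) : Measure (Config (d + 1) E) :=
  (Measure.infinitePi fun i : ℤ => K (layer i b)).map glue

theorem measurable_independentLayers (K : Kernel (Config d B) (Config d E)) [IsMarkovKernel K] :
    Measurable (independentLayers K) :=
  (Measure.measurable_map _ measurable_glue).comp
    (Measure.measurable_infinitePi fun i => K.measurable.comp (measurable_layer i))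

variable [Countable E] [DiscreteMeasurableSpace E]

/-- Conjugating the disintegration by the shift yields another disintegration of the same invariant
joint law; uniqueness makes the two agree almost everywhere. -/
theorem condDistrib_ae_shift [Nonempty (Config d E)] {π : E → B} (hπ : Measurable π)
    {μ : Measure (Config d E)} [IsProbabilityMeasure μ]
    (hμ : μ ∈ invMeasures d E) (k : Fin d → ℤ) :
    ∀ᵐ b ∂μ.map (mapCells π), condDistrib id (mapCells π) μ (shift k b) =
      (condDistrib id (mapCells π) μ b).map (shift k) := by
  have hX := measurable_mapCells (d := d) hπ
  set K := condDistrib id (mapCells π) μ with hK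
  have hρ := map_mapCells_mem_invMeasures hπ hμ
  have hinv : ∀ c : Config d B, shift (-k) (shift k c) = c := fun c => by
    rw [← Function.comp_apply (f := shift (-k)), ← shift_add, neg_add_cancel, shift_zero]; rfl
  have hinv' : (shift k ∘ shift (-k) : Config d E → Config d E) = id := by
    rw [← shift_add, add_neg_cancel, shift_zero]
  have hcomp : μ.map (fun ω => (mapCells π ω, id ω)) =
      μ.map (mapCells π) ⊗ₘ ((K.comap (shift k) (measurable_shift k)).map (shift (-k))) := by
    ext s hs
    have hS : Measurable (Prod.map (shift (-k)) (shift (-k)) :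
        Config d B × Config d E → Config d B × Config d E) :=
      (measurable_shift (-k)).prodMap (measurable_shift (-k))
    have hpair : Measurable fun ω : Config d E => (mapCells π ω, id ω) :=
      hX.prodMk measurable_id
    have hG : ∀ c, ((K.comap (shift k) (measurable_shift k)).map (shift (-k))) c
        (Prod.mk c ⁻¹' s) = (fun c => K c (Prod.mk c ⁻¹' (Prod.map (shift (-k)) (shift (-k)) ⁻¹' s)))
          (shift k c) := by
      intro c
      rw [Kernel.map_apply' _ (measurable_shift _) _ (measurable_prodMk_left hs),
        Kernel.comap_apply]
      congr 1
      ext y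
      simp [hinv]
    rw [Measure.compProd_apply hs, lintegral_congr hG,
      ((preservingAction_shift hρ).preserving k).lintegral_comp
        (Kernel.measurable_kernel_prodMk_left (hS hs)),
      ← Measure.compProd_apply (hS hs), hK, compProd_map_condDistrib aemeasurable_id,
      Measure.map_apply hpair (hS hs), Measure.map_apply hpair hs]
    conv_lhs => rw [← hμ.2 (-k), Measure.map_apply (measurable_shift _) (hpair hs)]
    rfl
  have hae := condDistrib_ae_eq_of_measure_eq_compProd (mapCells π) aemeasurable_id hcomp
  filter_upwards [hae] with b hb
  rw [← hK] at hb
  rw [hb, Kernel.map_apply _ (measurable_shift _), Kernel.comap_apply,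
    Measure.map_map (measurable_shift _) (measurable_shift _), hinv', Measure.map_id]

variable [Countable B] [DiscreteMeasurableSpace B]

theorem condDistrib_ae_fiber [Nonempty (Config d E)] {π : E → B} {μ : Measure (Config d E)} [IsProbabilityMeasure μ] :
    ∀ᵐ b ∂μ.map (mapCells π), ∀ᵐ y ∂condDistrib id (mapCells π) μ b, mapCells π y = b := by
  have hX := measurable_mapCells (d := d) (π := π) .of_discrete
  have hpair : Measurable fun ω : Config d E => (mapCells π ω, id ω) := hX.prodMk measurable_id
  have hset : MeasurableSet {p : Config d B × Config d E | mapCells π p.2 = p.1} :=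
    measurableSet_eq_fun (hX.comp measurable_snd) measurable_fst
  have h : ∀ᵐ p ∂(μ.map (mapCells π) ⊗ₘ condDistrib id (mapCells π) μ),
      mapCells π p.2 = p.1 := by
    rw [compProd_map_condDistrib aemeasurable_id, ae_map_iff hpair.aemeasurable hset]
    exact Eventually.of_forall fun ω => rfl
  exact Measure.ae_ae_of_ae_compProd h

/-- An invariant measure on `ℤ^d` lifts to `ℤ^{d+1}` along an invariant extension of
one of its factors. -/
theorem exists_lift {π : E → B} {κ : Measure (Config d E)} (hκ : κ ∈ invMeasures d E)
    {ν : Measure (Config (d + 1) B)} (hν : ν ∈ invMeasures (d + 1) B)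
    (h : κ.map (mapCells π) = ν.map restrictLayer) :
    ∃ κ' ∈ invMeasures (d + 1) E, κ'.map (mapCells π) = ν ∧ κ'.map restrictLayer = κ := by
  have := hκ.1
  have := hν.1
  have : Nonempty (Config d E) := nonempty_of_isProbabilityMeasure κ
  have hX := measurable_mapCells (d := d) (π := π) .of_discrete
  have hX' := measurable_mapCells (d := d + 1) (π := π) .of_discrete
  set K := condDistrib id (mapCells π) κ with hK
  set m := independentLayers K with hm
  have hmm : Measurable m := measurable_independentLayers K
  have hprob : ∀ b, IsProbabilityMeasure (m b) := fun b =>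
    Measure.isProbabilityMeasure_map measurable_glue.aemeasurable
  refine ⟨ν.bind m, ⟨?_, fun k => ?_⟩, ?_, ?_⟩
  · constructor
    rw [Measure.bind_apply .univ hmm.aemeasurable]
    simp
  · have hae : ∀ᵐ b ∂ν, (m b).map (shift k) = m (shift k b) := by
      have h0 := condDistrib_ae_shift (π := π) .of_discrete hκ (Fin.init (α := fun _ => ℤ) k)
      rw [h] at h0
      filter_upwards [ae_forall_layer hν h0] with b hb
      have hr : Measurable fun (y : ℤ → Config d E) i => y (k (Fin.last d) + i) := by fun_prop
      have hs : Measurable fun (y : ℤ → Config d E) i =>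
          shift (Fin.init (α := fun _ => ℤ) k) (y i) :=
        measurable_pi_lambda _ fun i => (measurable_shift _).comp (measurable_pi_apply i)
      simp only [hm, independentLayers, layer_shift]
      simp only [← hK] at hb
      simp only [hb]
      rw [← Measure.infinitePi_map_pi (fun i => K (layer (k (Fin.last d) + i) b))
          (fun _ => measurable_shift _),
        show (Measure.infinitePi fun i => K (layer (k (Fin.last d) + i) b)) = _ from
          (Measure.infinitePi_map_reindex (Equiv.addLeft (k (Fin.last d)))
            (fun i => K (layer i b))).symm,
        Measure.map_map measurable_glue hs,
        Measure.map_map (measurable_glue.comp hs) (by exact hr),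
        Measure.map_map (measurable_shift k) measurable_glue]
      rfl
    rw [Measure.map_bind_eq hmm (measurable_shift k),
      Measure.bind_congr_ae (m := fun b => (m b).map (shift k))
        ((Measure.measurable_map _ (measurable_shift k)).comp hmm)
        (m' := fun b => m (shift k b)) (hmm.comp (measurable_shift k)) hae,
      ← Measure.bind_map_eq (measurable_shift k) hmm, hν.2 k]
  -- Each factor of the product lives on the fiber over its layer of `b`, so the glued configuration
  -- projects to `b` itself.
  · have hae : ∀ᵐ b ∂ν, (m b).map (mapCells π) = Measure.dirac b := by
      have h0 := condDistrib_ae_fiber (π := π) (μ := κ)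
      rw [h] at h0
      filter_upwards [ae_forall_layer hν h0] with b hb
      have : ∀ᵐ ω ∂m b, mapCells π ω = b := by
        rw [hm, independentLayers, ae_map_iff measurable_glue.aemeasurable
          (measurableSet_eq_fun hX' measurable_const)]
        have : ∀ᵐ y ∂(Measure.infinitePi fun i : ℤ => K (layer i b)),
            ∀ i, mapCells π (y i) = layer i b := by
          rw [ae_all_iff]
          intro i
          have hi := hb i
          rw [← hK, ← Measure.infinitePi_map_eval (fun i : ℤ => K (layer i b)) i] at hi
          exact ae_of_ae_map (measurable_pi_apply i).aemeasurable hi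
        filter_upwards [this] with y hy
        calc mapCells π (glue y) = glue fun i => mapCells π (y i) := rfl
          _ = b := by simp only [hy, glue_layer]
      rw [Measure.map_congr this, Measure.map_const, measure_univ, one_smul]
    rw [Measure.map_bind_eq hmm hX',
      Measure.bind_congr_ae (m := fun b => (m b).map (mapCells π))
        ((Measure.measurable_map _ hX').comp hmm) Measure.measurable_dirac hae,
      Measure.bind_dirac]
  -- Layer zero is drawn from `K` at layer zero of `b`, whose law is the factor of `κ`; averaging
  -- `K` over it recovers `κ`.
  · have hr : ∀ b, (m b).map restrictLayer = K (restrictLayer b) := by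
      intro b
      have hc : restrictLayer ∘ glue = fun y : ℤ → Config d E => y 0 :=
        funext fun y => layer_glue 0 y
      rw [hm, independentLayers, Measure.map_map measurable_restrictLayer measurable_glue, hc]
      exact Measure.infinitePi_map_eval (fun i : ℤ => K (layer i b)) 0
    rw [Measure.map_bind_eq hmm measurable_restrictLayer]
    simp only [hr]
    rw [← Measure.bind_map_eq measurable_restrictLayer K.measurable, ← h, hK,
      condDistrib_comp_map hX.aemeasurable aemeasurable_id, Measure.map_id]

end Disintegration

end NoisySFT

/-! ### Transfer of the SFT, the noise and the distance between dimensions -/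

namespace NoisySFT

variable {d : ℕ} {A : Type*}

theorem mem_sft_iff {F : Set (Pattern d A)} {ω : Config d A} :
    ω ∈ sft F ↔ ∀ w ∈ F, ∀ k : Fin d → ℤ, ∃ l : w.window, ω (k + l) ≠ w.word l := by
  simp only [sft, Set.mem_ofPred_eq, ne_eq, funext_iff, not_forall, shift]

theorem mem_sft_extendPatterns_iff {F : Set (Pattern d A)} {ω : Config (d + 1) A} :
    ω ∈ sft (extendPatterns F) ↔ ∀ i, layer i ω ∈ sft F := by
  have hcell : ∀ (k : Fin (d + 1) → ℤ) (l : Fin d → ℤ), k + baseCell l =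
      Fin.snoc (α := fun _ => ℤ) (Fin.init (α := fun _ => ℤ) k + l) (k (Fin.last d)) := by
    intro k l
    ext j
    refine Fin.lastCases ?_ (fun j => ?_) j <;> simp [Fin.init, baseCell]
  have hword : ∀ (w : Pattern d A) (l : Fin d → ℤ) (hl : l ∈ w.window)
      (h : baseCell l ∈ w.extend.window), w.extend.word ⟨baseCell l, h⟩ = w.word ⟨l, hl⟩ := by
    intro w l hl h
    simp only [Pattern.extend, init_baseCell]
  simp only [mem_sft_iff, extendPatterns, Set.forall_mem_image, layer]
  constructor
  · intro h i w hw k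
    obtain ⟨⟨_, hm⟩, hl⟩ := h hw (Fin.snoc (α := fun _ => ℤ) k i)
    obtain ⟨l, hlw, rfl⟩ := Finset.mem_map.1 hm
    refine ⟨⟨l, hlw⟩, ?_⟩
    simpa [hword w l hlw, hcell] using hl
  · intro h w hw k
    obtain ⟨⟨l, hlw⟩, hl⟩ := h (k (Fin.last d)) w hw (Fin.init (α := fun _ => ℤ) k)
    have hm : baseCell l ∈ w.extend.window := Finset.mem_map.2 ⟨l, hlw, rfl⟩
    refine ⟨⟨baseCell l, hm⟩, ?_⟩
    rw [hword w l hlw hm, hcell]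
    exact hl

theorem clearPatterns_extendPatterns (F : Set (Pattern d A)) :
    clearPatterns (extendPatterns F) = extendPatterns (clearPatterns F) :=
  Set.image_comm fun _ => rfl

variable [MeasurableSpace A]

theorem measurableSet_sft [Countable A] [DiscreteMeasurableSpace A] {F : Set (Pattern d A)}
    (hF : F.Countable) : MeasurableSet (sft F) := by
  have : sft F = ⋂ w ∈ F, ⋂ k : Fin d → ℤ, ⋃ l : w.window,
      (fun ω : Config d A => ω (k + l)) ⁻¹' {w.word l}ᶜ := by
    ext ω; simp [mem_sft_iff]
  rw [this]
  exact .biInter hF fun w _ => .iInter fun k => .iUnion fun l =>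
    measurable_pi_apply _ (MeasurableSet.of_discrete)

theorem mem_sftMeasures_extendPatterns_iff [Countable A] [DiscreteMeasurableSpace A]
    {F : Set (Pattern d A)} (hF : F.Countable) {μ : Measure (Config (d + 1) A)}
    (hμ : μ ∈ invMeasures (d + 1) A) :
    μ ∈ sftMeasures (extendPatterns F) ↔ μ.map restrictLayer ∈ sftMeasures F := by
  constructor
  · rintro ⟨-, h⟩
    refine ⟨map_restrictLayer_mem_invMeasures hμ, ?_⟩
    refine (ae_map_iff (p := (· ∈ sft F)) measurable_restrictLayer.aemeasurable
      (measurableSet_sft hF)).2 ?_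
    exact h.mono fun ω hω => mem_sft_extendPatterns_iff.1 hω 0
  · rintro ⟨-, h⟩
    exact ⟨hμ, (ae_forall_layer hμ h).mono fun ω hω => mem_sft_extendPatterns_iff.2 hω⟩

theorem map_mapCells_restrictLayer {B : Type*} [MeasurableSpace B] {π : A → B}
    (hπ : Measurable π) (μ : Measure (Config (d + 1) A)) :
    (μ.map restrictLayer).map (mapCells π) = (μ.map (mapCells π)).map restrictLayer := by
  rw [Measure.map_map (measurable_mapCells hπ) measurable_restrictLayer,
    Measure.map_map measurable_restrictLayer (measurable_mapCells hπ)]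
  rfl

theorem baseCell_zero : baseCell (0 : Fin d → ℤ) = 0 := by
  ext j
  refine Fin.lastCases ?_ (fun j => ?_) j <;> simp [baseCell]

theorem isNoise_map_restrictLayer_iff {ε : unitInterval} {ν : Measure (Config (d + 1) (Fin 2))}
    (hν : ν ∈ invMeasures (d + 1) (Fin 2)) :
    IsNoise ε (ν.map restrictLayer) ↔ IsNoise ε ν := by
  have hm : MeasurableSet {b : Config d (Fin 2) | b 0 = 1} :=
    measurable_pi_apply (X := fun _ => Fin 2) (0 : Fin d → ℤ) (measurableSet_singleton 1)
  have : ν.map restrictLayer {b | b 0 = 1} = ν {b | b 0 = 1} := by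
    rw [Measure.map_apply measurable_restrictLayer hm]
    simp only [Set.preimage_ofPred_eq, restrictLayer, baseCell_zero]
  simp only [IsNoise, this, hν, map_restrictLayer_mem_invMeasures hν, true_and]

theorem invMeasures_of_mem_noisyMeasures {F : Set (Pattern d A)}
    {N : Set (Measure (Config d (Fin 2)))} {ε : unitInterval} {μ : Measure (Config d A)}
    (hμ : μ ∈ noisyMeasures F N ε) : μ ∈ invMeasures d A := by
  obtain ⟨l, hl, rfl⟩ := hμ
  exact map_mapCells_mem_invMeasures measurable_fst hl.1.1

variable [Countable A] [DiscreteMeasurableSpace A]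

/-- The noisy measures on `ℤ^d` are the restrictions of those on `ℤ^{d+1}`. -/
theorem noisyMeasures_restrictClass {F : Set (Pattern d A)} (hF : F.Countable)
    {N' : Set (Measure (Config (d + 1) (Fin 2)))} (hN' : N' ⊆ invMeasures (d + 1) (Fin 2))
    (ε : unitInterval) :
    noisyMeasures F (restrictClass N') ε =
      (fun μ => μ.map restrictLayer) '' noisyMeasures (extendPatterns F) N' ε := by
  have hFc : (clearPatterns F).Countable := hF.image _
  ext μ
  constructor
  · rintro ⟨l, ⟨hl, ⟨ν, hν, hνl⟩, hnoise⟩, rfl⟩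
    -- The noise component is the factor: the lift carries the prescribed noise `ν` of `N'`.
    -- Forbidden clear patterns are absent because they are absent from layer zero.
    obtain ⟨l', hl', hl'ν, rfl⟩ := exists_lift (π := Prod.snd) hl.1 (hN' hν) hνl.symm
    refine ⟨l'.map projFst, ⟨l', ⟨?_, ?_, ?_⟩, rfl⟩, ?_⟩
    · rw [clearPatterns_extendPatterns]
      exact (mem_sftMeasures_extendPatterns_iff hFc hl').2 hl
    · rwa [projSnd_eq_mapCells, hl'ν]
    · rw [projSnd_eq_mapCells, hl'ν, ← isNoise_map_restrictLayer_iff (hN' hν)]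
      simp only at hνl
      rwa [hνl]
    · exact (map_mapCells_restrictLayer measurable_fst l').symm
  · rintro ⟨_, ⟨l, ⟨hl, hlN, hnoise⟩, rfl⟩, rfl⟩
    have hsnd : (l.map restrictLayer).map projSnd = (l.map projSnd).map restrictLayer :=
      map_mapCells_restrictLayer measurable_snd l
    refine ⟨l.map restrictLayer, ⟨?_, ?_, ?_⟩, map_mapCells_restrictLayer measurable_fst l⟩
    · rw [clearPatterns_extendPatterns] at hl
      exact (mem_sftMeasures_extendPatterns_iff hFc hl.1).1 hl
    · exact ⟨_, hlN, hsnd.symm⟩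
    · rw [hsnd]
      exact (isNoise_map_restrictLayer_iff hnoise.1).2 hnoise

theorem map_restrictLayer_diffAtZero (l : Measure (Config (d + 1) (A × A))) :
    l.map restrictLayer (diffAtZero d A) = l (diffAtZero (d + 1) A) := by
  rw [Measure.map_apply measurable_restrictLayer measurableSet_diffAtZero]
  simp only [diffAtZero, Set.preimage_ofPred_eq, restrictLayer, baseCell_zero]

/-- The distance of an invariant measure to the measures of the SFT does not change by restriction
to a layer. -/
theorem iInf_dB_restrictLayer {F : Set (Pattern d A)} (hF : F.Countable)
    {μ : Measure (Config (d + 1) A)} (hμ : μ ∈ invMeasures (d + 1) A) :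
    ⨅ ν ∈ sftMeasures F, dB (μ.map restrictLayer) ν =
      ⨅ ν ∈ sftMeasures (extendPatterns F), dB μ ν := by
  simp only [dB_eq]
  refine le_antisymm ?_ ?_
  · refine le_iInf₂ fun ν hν => le_iInf₂ fun l hl => ?_
    -- Couplings restrict to couplings at the same cost, as the origin lies in layer zero.
    refine iInf₂_le_of_le (ν.map restrictLayer)
      ((mem_sftMeasures_extendPatterns_iff hF hν.1).1 hν) ?_
    refine iInf₂_le_of_le (l.map restrictLayer) ⟨map_restrictLayer_mem_invMeasures hl.1, ?_, ?_⟩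
      (map_restrictLayer_diffAtZero l).le
    · rw [projFst_eq_mapCells, map_mapCells_restrictLayer measurable_fst]
      exact congrArg _ hl.2.1
    · rw [projSnd_eq_mapCells, map_mapCells_restrictLayer measurable_snd]
      exact congrArg _ hl.2.2
  · refine le_iInf₂ fun ν hν => le_iInf₂ fun l hl => ?_
    -- The coupling is lifted over its first component, prescribed to be `μ`; the second marginal of
    -- the lift is then the competitor carried by the extended SFT.
    obtain ⟨l', hl', hl'μ, rfl⟩ := exists_lift (π := Prod.fst) hl.1 hμ hl.2.1
    have hν' : l'.map projSnd ∈ invMeasures (d + 1) A :=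
      map_mapCells_mem_invMeasures measurable_snd hl'
    refine iInf₂_le_of_le (l'.map projSnd) ?_
      (iInf₂_le_of_le l' ⟨hl', hl'μ, rfl⟩ (map_restrictLayer_diffAtZero l').ge)
    rw [mem_sftMeasures_extendPatterns_iff hF hν']
    rw [projSnd_eq_mapCells, ← map_mapCells_restrictLayer measurable_snd, ← projSnd_eq_mapCells,
      hl.2.2]
    exact hν

theorem isFStable_restrictClass_iff {F : Set (Pattern d A)} (hF : F.Countable)
    {N' : Set (Measure (Config (d + 1) (Fin 2)))} (hN' : N' ⊆ invMeasures (d + 1) (Fin 2))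
    (f : unitInterval → ℝ≥0) :
    IsFStable dB F (restrictClass N') f ↔ IsFStable dB (extendPatterns F) N' f := by
  refine forall_congr' fun ε => ?_
  rw [noisyMeasures_restrictClass hF hN', iSup_image]
  have h : ∀ μ ∈ noisyMeasures (extendPatterns F) N' ε,
      ⨅ ν ∈ sftMeasures F, dB (μ.map restrictLayer) ν =
        ⨅ ν ∈ sftMeasures (extendPatterns F), dB μ ν := fun μ hμ =>
    iInf_dB_restrictLayer hF (invMeasures_of_mem_noisyMeasures hμ)
  rw [iSup_congr fun μ => iSup_congr (h μ)]

end NoisySFT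

theorem mainTheorem8 {d : ℕ} (hd : 0 < d) {A : Type*} [Finite A] [MeasurableSpace A]
    [DiscreteMeasurableSpace A] (F : Set (Pattern d A)) (hF : F.Finite)
    (hne : (sft F).Nonempty) (N' : Set (Measure (Config (d + 1) (Fin 2))))
    (hN' : N' ⊆ invMeasures (d + 1) (Fin 2)) :
    (∀ f : unitInterval → ℝ≥0, IsSpeed f →
      (IsFStable dB F (restrictClass N') f ↔ IsFStable dB (extendPatterns F) N' f)) ∧
    (IsUnstable dB F (restrictClass N') ↔ IsUnstable dB (extendPatterns F) N') := by
  have h := isFStable_restrictClass_iff hF.countable hN'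
  exact ⟨fun f _ => h f, not_congr (exists_congr fun f => and_congr_right fun _ => h f)⟩
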